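/- For a finite simple graph $G$ with vertex set $V(G)$, let $$X_G=\sum_{\kappa}\ \prod_{v\in V(G)} x_{\kappa(v)}$$ be its chromatic symmetric function, a formal power series in $x_1,x_2,\dots$ over $\mathbb{Q}$, where $\kappa$ ranges over all maps $\kappa:V(G)\to\mathbb{Z}^{+}$ such that $\kappa(u)\neq\kappa(v)$ whenever $u$ and $v$ are adjacent. Let $\Lambda$ be the $\mathbb{Q}$-algebra of symmetric functions, i.e. of the formal power series of bounded degree in $x_1,x_2,\dots$ over $\mathbb{Q}$ that are invariant under all permutations of the variables, and for $n\ge 0$ let $\Lambda^n$ be the $\mathbb{Q}$-vector space of symmetric functions that are homogeneous of degree $n$ (together with $0$). For every $k\geq 1$ let $T_k$ be a tree with $k$ vertices. For a partition $\lambda=(\lambda_1,\dots,\lambda_\ell)$ let $T_\lambda=T_{\lambda_1}\sqcup\cdots\sqcup T_{\lambda_\ell}$ be the disjoint union. Then: 1. for every $n\ge 0$, the family $(X_{T_\lambda})_{\lambda\vdash n}$, indexed by the partitions of $n$, is a $\mathbb{Q}$-basis of $\Lambda^n$; 2. $\Lambda=\mathbb{Q}[X_{T_1},X_{T_2},\dots]$,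 i.e. $\Lambda$ is generated as a $\mathbb{Q}$-algebra by the $X_{T_k}$, $k\ge 1$; 3. the $X_{T_k}$, $k\geq 1$, are algebraically independent over $\mathbb{Q}$. -/

import Mathlib

noncomputable section

namespace ChromaticBases

/-- The content of a colouring `κ : V → ℤ⁺`: the exponent vector of the monomial
`∏ v, x_{κ v}`, whose value at a colour `i` is the number of vertices of colour `i`. -/
def content {V : Type*} [Fintype V] (κ : V → ℕ+) : ℕ+ →₀ ℕ :=
  ∑ v, Finsupp.single (κ v) 1

/-- Only finitely many proper colourings have a given content, so that the formal sum that defines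
the chromatic symmetric function makes sense. -/
theorem finite_coloring_content {V : Type*} [Fintype V] (G : SimpleGraph V) (d : ℕ+ →₀ ℕ) :
    Finite {κ : G.Coloring ℕ+ // content κ = d} := by
  classical
  have key : ∀ κ : {κ : G.Coloring ℕ+ // content κ = d}, ∀ v, κ.1 v ∈ d.support := by
    rintro ⟨κ, rfl⟩ v
    rw [Finsupp.mem_support_iff]
    intro h
    simp only [content, Finsupp.finsetSum_apply] at h
    have := (Finset.sum_eq_zero_iff.mp h) v (Finset.mem_univ v)
    simp at this
  refine Finite.of_injective
    (fun κ (v : V) => (⟨κ.1 v, key κ v⟩ : {i // i ∈ d.support})) ?_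
  intro κ κ' h
  apply Subtype.ext
  apply DFunLike.ext
  intro v
  exact congrArg Subtype.val (congrFun h v)

/-- The chromatic symmetric function `X_G = ∑_κ ∏_v x_{κ v}` of a finite simple graph, the sum
ranging over all proper colourings `κ : V → ℤ⁺`, as a formal power series in `x₁, x₂, …` over `ℚ`:
the coefficient of `x^d` is the number of proper colourings `κ` with `∏_v x_{κ v} = x^d`. -/
def csf {V : Type*} [Fintype V] (G : SimpleGraph V) : MvPowerSeries ℕ+ ℚ :=
  fun d => (Nat.card {κ : G.Coloring ℕ+ // content κ = d} : ℚ)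

/-- A formal power series in `x₁, x₂, …` is symmetric if every permutation of the variables
fixes it. -/
def IsSymm (f : MvPowerSeries ℕ+ ℚ) : Prop :=
  ∀ σ : Equiv.Perm ℕ+, MvPowerSeries.renameEquiv ℚ σ f = f

/-- The `ℚ`-algebra `Λ` of symmetric functions: symmetric formal power series of bounded degree in
the variables `x₁, x₂, …`. -/
def Lam : Subalgebra ℚ (MvPowerSeries ℕ+ ℚ) where
  carrier := {f | IsSymm f ∧ ∃ N : ℕ, ∀ d : ℕ+ →₀ ℕ, MvPowerSeries.coeff d f ≠ 0 → d.degree ≤ N}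
  mul_mem' := by
    classical
    rintro f g ⟨hf, N, hN⟩ ⟨hg, M, hM⟩
    refine ⟨fun σ => by rw [map_mul, hf σ, hg σ], N + M, fun d hd => ?_⟩
    rw [MvPowerSeries.coeff_mul] at hd
    obtain ⟨p, hp, hne⟩ := Finset.exists_ne_zero_of_sum_ne_zero hd
    rw [← Finset.HasAntidiagonal.mem_antidiagonal.mp hp, map_add]
    exact add_le_add (hN _ (left_ne_zero_of_mul hne)) (hM _ (right_ne_zero_of_mul hne))
  add_mem' := by
    rintro f g ⟨hf, N, hN⟩ ⟨hg, M, hM⟩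
    refine ⟨fun σ => by rw [map_add, hf σ, hg σ], max N M, fun d hd => ?_⟩
    rw [map_add] at hd
    by_cases h : MvPowerSeries.coeff d f = 0
    · exact (hM d fun h' => hd (by rw [h, h', add_zero])).trans (le_max_right _ _)
    · exact (hN d h).trans (le_max_left _ _)
  algebraMap_mem' := by
    classical
    intro r
    refine ⟨fun σ => AlgEquiv.commutes _ r, 0, fun d hd => ?_⟩
    rw [MvPowerSeries.algebraMap_apply, MvPowerSeries.coeff_C] at hd
    have : d = 0 := by
      by_contra h
      simp [h] at hd
    simp [this]

/-- The `ℚ`-vector space `Λⁿ` of homogeneous symmetric functions of degree `n` (with `0`). -/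
def LamDeg (n : ℕ) : Submodule ℚ (MvPowerSeries ℕ+ ℚ) where
  carrier := {f | IsSymm f ∧ f.IsHomogeneous n}
  add_mem' := by
    rintro f g ⟨hf, hf'⟩ ⟨hg, hg'⟩
    exact ⟨fun σ => by rw [map_add, hf σ, hg σ], hf'.add hg'⟩
  zero_mem' := ⟨fun σ => map_zero _, fun hd => absurd (map_zero _) hd⟩
  smul_mem' := by
    rintro c f ⟨hf, hf'⟩
    refine ⟨fun σ => by rw [map_smul, hf σ], fun hd => hf' fun h => hd ?_⟩
    rw [MvPowerSeries.coeff_smul, h, mul_zero]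

/-- The disjoint union `⨆ i, G i` of a family of graphs, on the disjoint union of the vertex
sets. -/
def disjointUnion {ι : Type*} {W : ι → Type*} (G : ∀ i, SimpleGraph (W i)) :
    SimpleGraph (Σ i, W i) :=
  ⨆ i, (G i).map (Function.Embedding.sigmaMk i)

theorem disjointUnion_adj {ι : Type*} {W : ι → Type*} (G : ∀ i, SimpleGraph (W i))
    (x y : Σ i, W i) :
    (disjointUnion G).Adj x y ↔
      ∃ (i : ι) (a b : W i), (G i).Adj a b ∧ x = ⟨i, a⟩ ∧ y = ⟨i, b⟩ := by
  simp [disjointUnion, SimpleGraph.iSup_adj, SimpleGraph.map_adj, eq_comm]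

/-- A part of a partition, as a positive integer. The type `p.parts.ToType` has one element for
each part of `p`, counted with multiplicity. -/
def part {n : ℕ} (p : n.Partition) (i : p.parts.ToType) : ℕ+ :=
  ⟨i.1, p.parts_pos (Multiset.coe_mem)⟩

/-- The graph `G_λ = G_{λ₁} ⊔ ⋯ ⊔ G_{λ_ℓ}` attached to a sequence of graphs `G₁, G₂, …` and a
partition `λ = (λ₁, …, λ_ℓ)`. -/
def partitionGraph {V : ℕ+ → Type*} (G : ∀ k, SimpleGraph (V k)) {n : ℕ} (p : n.Partition) :
    SimpleGraph (Σ i : p.parts.ToType, V (part p i)) :=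
  disjointUnion fun i => G (part p i)

end ChromaticBases

end

/-!
Give the vertices of a graph positive weights and let a vertex of weight `w` and colour `i`
contribute `x_i ^ w`. The weighted chromatic symmetric function of a graph with edge `uv` is that of
`G - uv` minus that of the contraction of `uv`, in which the merged vertex carries both weights.
Iterating this down to edgeless graphs, where the function is a product of power sums, gives
`X_G = ± c p_m + (a polynomial in p_1, …, p_{m-1})`, where `m` is the total weight and `c` counts
the ways to end at a single vertex. If `G` is connected, then `c ≠ 0`. Hence the `X_G` of connected
graphs with `1, 2, …` vertices generate the same algebra as the power sums.

The products of power sums `p_λ` with `λ ⊢ n` are triangular with respect to the number of parts of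
`λ`, since merging colours in `p_λ` only produces monomials with fewer variables; so they form a
basis of `Λⁿ`. By a dimension count, the products of any homogeneous generators of degrees
`1, 2, …` are then bases as well, which also makes these generators algebraically independent.
-/

noncomputable section

namespace ChromaticBases

open Finset MvPowerSeries
open Filter (TendstoCofinite)

section CountSeries

variable {σ R S S' : Type*}

/-- The generating series `∑ s, x ^ c s` of a family of exponent vectors. It is meaningful when
`c` has finite fibres; `Nat.card` turns the coefficient at an infinite fibre into `0`. -/
def countSeries [Semiring R] (c : S → σ →₀ ℕ) : MvPowerSeries σ R :=
  fun d => Nat.card {s // c s = d}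

theorem coeff_countSeries [Semiring R] (c : S → σ →₀ ℕ) (d : σ →₀ ℕ) :
    coeff d (countSeries c : MvPowerSeries σ R) = Nat.card {s // c s = d} := rfl

theorem exists_eq_of_coeff_countSeries_ne_zero [Semiring R] {c : S → σ →₀ ℕ} {d : σ →₀ ℕ}
    (h : coeff d (countSeries c : MvPowerSeries σ R) ≠ 0) : ∃ s, c s = d := by
  contrapose! h
  have : IsEmpty {s // c s = d} := ⟨fun s => h s.1 s.2⟩
  simp [coeff_countSeries]

theorem finite_fiber (c : S → σ →₀ ℕ) [TendstoCofinite c] (d : σ →₀ ℕ) : Finite {s // c s = d} :=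
  (TendstoCofinite.finite_preimage_singleton c d).to_subtype

theorem coeff_countSeries_ne_zero [Semiring R] [CharZero R] (c : S → σ →₀ ℕ) [TendstoCofinite c]
    (s : S) : coeff (c s) (countSeries c : MvPowerSeries σ R) ≠ 0 := by
  have := finite_fiber c (c s)
  have : Nonempty {t // c t = c s} := ⟨⟨s, rfl⟩⟩
  exact Nat.cast_ne_zero.2 Nat.card_pos.ne'

theorem countSeries_congr [Semiring R] {c : S → σ →₀ ℕ} {c' : S' → σ →₀ ℕ} (e : S ≃ S')
    (h : ∀ s, c' (e s) = c s) : (countSeries c : MvPowerSeries σ R) = countSeries c' := by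
  ext d
  rw [coeff_countSeries, coeff_countSeries,
    Nat.card_congr (e.subtypeEquiv (q := fun s => c' s = d) fun s => by rw [h])]

theorem countSeries_sumElim [Semiring R] (c : S → σ →₀ ℕ) (c' : S' → σ →₀ ℕ)
    [TendstoCofinite c] [TendstoCofinite c'] :
    (countSeries (Sum.elim c c') : MvPowerSeries σ R) = countSeries c + countSeries c' := by
  ext d
  have : Finite {a // Sum.elim c c' (.inl a) = d} := finite_fiber c d
  have : Finite {b // Sum.elim c c' (.inr b) = d} := finite_fiber c' d
  rw [map_add, coeff_countSeries, Nat.card_congr Equiv.subtypeSum]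
  exact (congrArg Nat.cast Nat.card_sum).trans (Nat.cast_add _ _)

/-- A choice of `s i` for every `i` with `∑ i, c i (s i) = d` amounts to a decomposition of `d`
together with elements of the fibres of the `c i` over its summands. -/
def sumFiberEquiv {ι : Type*} [Fintype ι] [DecidableEq ι] [DecidableEq σ] {S : ι → Type*}
    (c : ∀ i, S i → σ →₀ ℕ) (d : σ →₀ ℕ) :
    {s : ∀ i, S i // ∑ i, c i (s i) = d} ≃
      Σ q : finsuppAntidiag (univ : Finset ι) d, ∀ i, {s // c i s = q.1 i} where
  toFun s := ⟨⟨Finsupp.equivFunOnFinite.symm fun i => c i (s.1 i), by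
    simpa [mem_finsuppAntidiag] using s.2⟩, fun i => ⟨s.1 i, rfl⟩⟩
  invFun q := ⟨fun i => (q.2 i).1,
    (sum_congr rfl fun i _ => (q.2 i).2).trans (mem_finsuppAntidiag.1 q.1.2).1⟩
  left_inv _ := rfl
  right_inv := by
    rintro ⟨⟨q, hq⟩, s⟩
    obtain ⟨t, ht, rfl⟩ : ∃ (t : ∀ i, S i) (ht : ∀ i, c i (t i) = q i),
        s = fun i => ⟨t i, ht i⟩ := ⟨fun i => (s i).1, fun i => (s i).2, rfl⟩
    obtain rfl : q = Finsupp.equivFunOnFinite.symm fun i => c i (t i) :=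
      Finsupp.ext fun i => (ht i).symm
    rfl

theorem prod_countSeries [CommSemiring R] {ι : Type*} [Fintype ι] {S : ι → Type*}
    (c : ∀ i, S i → σ →₀ ℕ) [∀ i, TendstoCofinite (c i)] :
    ∏ i, (countSeries (c i) : MvPowerSeries σ R) =
      countSeries fun s : ∀ i, S i => ∑ i, c i (s i) := by
  classical
  ext d
  have := fun i => finite_fiber (c i)
  simp only [coeff_prod, coeff_countSeries, Nat.card_congr (sumFiberEquiv c d), Nat.card_sigma,
    Nat.card_pi, Nat.cast_sum, Nat.cast_prod]
  exact (sum_coe_sort _ fun q : ι →₀ σ →₀ ℕ => ∏ i, (Nat.card {s // c i s = q i} : R)).symm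

theorem isHomogeneous_countSeries [Semiring R] {c : S → σ →₀ ℕ} {n : ℕ}
    (h : ∀ s, (c s).degree = n) : (countSeries c : MvPowerSeries σ R).IsHomogeneous n := by
  intro d hd
  obtain ⟨s, rfl⟩ := exists_eq_of_coeff_countSeries_ne_zero hd
  rw [← h s, Finsupp.degree_eq_weight_one]
  rfl

end CountSeries

section WeightedContent

variable {σ V : Type*} [Fintype V]

/-- The exponent vector of the monomial `∏ v, x_{κ v} ^ (w v)`: the content of a colouring `κ` of
vertices that carry positive weights. -/
def weightedContent (w : V → ℕ+) (κ : V → σ) : σ →₀ ℕ :=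
  ∑ v, Finsupp.single (κ v) (w v : ℕ)

theorem weightedContent_apply [DecidableEq σ] (w : V → ℕ+) (κ : V → σ) (i : σ) :
    weightedContent w κ i = ∑ v, if κ v = i then (w v : ℕ) else 0 := by
  simp only [weightedContent, Finsupp.finsetSum_apply, Finsupp.single_apply]

theorem support_weightedContent [DecidableEq σ] (w : V → ℕ+) (κ : V → σ) :
    (weightedContent w κ).support = univ.image κ := by
  ext i
  simp [weightedContent_apply]

theorem degree_weightedContent (w : V → ℕ+) (κ : V → σ) :
    (weightedContent w κ).degree = ∑ v, (w v : ℕ) := by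
  simp only [weightedContent, map_sum, Finsupp.degree_single]

theorem mapDomain_weightedContent {τ : Type*} (f : σ → τ) (w : V → ℕ+) (κ : V → σ) :
    (weightedContent w κ).mapDomain f = weightedContent w (f ∘ κ) := by
  simp only [weightedContent, Finsupp.mapDomain_finsetSum, Finsupp.mapDomain_single,
    Function.comp_apply]

instance tendstoCofinite_weightedContent (w : V → ℕ+) :
    TendstoCofinite (weightedContent w : (V → σ) → σ →₀ ℕ) := by
  classical
  rw [Filter.tendstoCofinite_iff_finite_preimage_singleton]
  refine fun d => (Set.Finite.pi' fun _ : V => d.support.finite_toSet).subset ?_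
  rintro κ rfl v
  rw [support_weightedContent]
  exact mem_coe.2 (mem_image_of_mem κ (mem_univ v))

end WeightedContent

section Exponents

variable {σ : Type*}

/-- The multiset of nonzero exponents of the monomial `x ^ d`, which determines the orbit of
`x ^ d` under permutations of the variables. -/
def exponents (d : σ →₀ ℕ) : Multiset ℕ :=
  d.support.val.map d

theorem card_exponents (d : σ →₀ ℕ) : (exponents d).card = d.support.card :=
  Multiset.card_map _ _

theorem exponents_weightedContent {V : Type*} [Fintype V] (w : V → ℕ+) {κ : V → σ}
    (hκ : Function.Injective κ) :
    exponents (weightedContent w κ) = univ.val.map fun v => (w v : ℕ) := by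
  classical
  rw [exponents, support_weightedContent, image_val_of_injOn hκ.injOn, Multiset.map_map]
  refine Multiset.map_congr rfl fun v _ => ?_
  simp [weightedContent_apply, hκ.eq_iff]

theorem exists_equiv_of_map_univ_eq {α β γ : Type*} [Fintype α] [Fintype β] {f : α → γ}
    {g : β → γ} (h : univ.val.map f = univ.val.map g) : ∃ e : α ≃ β, ∀ a, g (e a) = f a := by
  classical
  have card_fiber (c : γ) : Fintype.card {a // f a = c} = Fintype.card {b // g b = c} := by
    have hc := congrArg (Multiset.count c) h
    simpa only [Multiset.count_map, Fintype.card_subtype, card_def, filter_val, eq_comm] using hc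
  exact ⟨.ofFiberEquiv fun c => Fintype.equivOfCardEq (card_fiber c), Equiv.ofFiberEquiv_map _⟩

theorem exists_perm_mapDomain_eq {d d' : σ →₀ ℕ} (h : exponents d = exponents d') :
    ∃ τ : Equiv.Perm σ, d.mapDomain τ = d' := by
  classical
  have map_attach (f : σ →₀ ℕ) :
      (univ : Finset f.support).val.map (fun i : f.support => f i) = exponents f :=
    Multiset.attach_map_val' f.support.val f
  obtain ⟨e, he⟩ : ∃ e : d.support ≃ d'.support, ∀ i, d' (e i) = d i :=
    exists_equiv_of_map_univ_eq ((map_attach d).trans (h.trans (map_attach d').symm))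
  obtain ⟨τ, hτ⟩ : ∃ τ : Equiv.Perm σ, ∀ i : d.support, τ i = e i := by
    let x : Fin d.support.card ↪ σ := d.support.equivFin.symm.toEmbedding.trans (.subtype _)
    let y := (d.support.equivFin.symm.trans e).toEmbedding.trans (.subtype _)
    have := Equiv.Perm.isMultiplyPretransitive σ d.support.card
    obtain ⟨τ, hτ⟩ := MulAction.exists_smul_eq (Equiv.Perm σ) x y
    refine ⟨τ, fun i => ?_⟩
    simpa [x, y] using DFunLike.congr_fun hτ (d.support.equivFin i)
  refine ⟨τ, ?_⟩
  calc d.mapDomain τ = ∑ i : d.support, Finsupp.single (τ i) (d i) :=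
        (sum_coe_sort d.support fun i => Finsupp.single (τ i) (d i)).symm
    _ = ∑ i : d.support, Finsupp.single (e i : σ) (d' (e i)) :=
        sum_congr rfl fun i _ => by rw [hτ, he]
    _ = ∑ i : d'.support, Finsupp.single (i : σ) (d' i) :=
        e.sum_comp fun i : d'.support => Finsupp.single (i : σ) (d' i)
    _ = d' := (sum_coe_sort _ fun i => Finsupp.single i (d' i)).trans d'.sum_single

end Exponents

section SymmetricFunctions

theorem isSymm_iff_coeff_mapDomain {f : MvPowerSeries ℕ+ ℚ} :
    IsSymm f ↔ ∀ (τ : Equiv.Perm ℕ+) (d : ℕ+ →₀ ℕ), coeff (d.mapDomain τ) f = coeff d f := by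
  have coeff_rename (τ : Equiv.Perm ℕ+) (d : ℕ+ →₀ ℕ) :
      coeff (d.mapDomain τ) (renameEquiv ℚ τ f) = coeff d f := by
    rw [← coeff_embDomain_rename τ.toEmbedding f d, Finsupp.embDomain_eq_mapDomain]
    rfl
  refine ⟨fun h τ d => by rw [← coeff_rename τ d, h τ], fun h τ => ?_⟩
  ext d
  obtain ⟨d, rfl⟩ : ∃ d' : ℕ+ →₀ ℕ, d'.mapDomain τ = d :=
    ⟨d.mapDomain τ.symm, by rw [← Finsupp.mapDomain_comp]; simp⟩
  rw [coeff_rename, h]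

theorem isSymm_countSeries {S : Type*} {c : S → ℕ+ →₀ ℕ} (a : Equiv.Perm ℕ+ → S ≃ S)
    (h : ∀ τ s, c (a τ s) = (c s).mapDomain τ) : IsSymm (countSeries c) := by
  refine isSymm_iff_coeff_mapDomain.2 fun τ d => ?_
  have e : {s // c s = d} ≃ {s // c s = d.mapDomain τ} := (a τ).subtypeEquiv fun s => by
    rw [h, (Finsupp.mapDomain_injective (M := ℕ) τ.injective).eq_iff]
  rw [coeff_countSeries, coeff_countSeries, Nat.card_congr e]

theorem IsSymm.coeff_eq_of_exponents_eq {f : MvPowerSeries ℕ+ ℚ} (hf : IsSymm f)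
    {d d' : ℕ+ →₀ ℕ} (h : exponents d = exponents d') : coeff d f = coeff d' f := by
  obtain ⟨τ, rfl⟩ := exists_perm_mapDomain_eq h
  exact (isSymm_iff_coeff_mapDomain.1 hf τ d).symm

theorem IsSymm.homogeneousComponent {f : MvPowerSeries ℕ+ ℚ} (hf : IsSymm f) (n : ℕ) :
    IsSymm (f.homogeneousComponent n) := by
  refine isSymm_iff_coeff_mapDomain.2 fun τ d => ?_
  rw [coeff_homogeneousComponent, coeff_homogeneousComponent,
    isSymm_iff_coeff_mapDomain.1 hf, Finsupp.degree_mapDomain]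

theorem countSeries_mem_LamDeg {S : Type*} {c : S → ℕ+ →₀ ℕ} {n : ℕ} (a : Equiv.Perm ℕ+ → S ≃ S)
    (h : ∀ τ s, c (a τ s) = (c s).mapDomain τ) (hn : ∀ s, (c s).degree = n) :
    countSeries c ∈ LamDeg n :=
  ⟨isSymm_countSeries a h, isHomogeneous_countSeries hn⟩

theorem homogeneousComponent_of_mem_LamDeg {f : MvPowerSeries ℕ+ ℚ} {m : ℕ} (hf : f ∈ LamDeg m)
    (n : ℕ) : f.homogeneousComponent n = if m = n then f else 0 := by
  split_ifs with h
  · exact (isHomogeneous_iff_eq_homogeneousComponent.1 (h ▸ hf.2)).symm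
  · ext d
    rw [coeff_homogeneousComponent, map_zero]
    refine ite_eq_right_iff.2 fun hd => IsHomogeneous.coeff_eq_zero hf.2 ?_
    rwa [hd, ne_comm]

theorem homogeneousComponent_mem_of_mem_iSup {U : ℕ → Submodule ℚ (MvPowerSeries ℕ+ ℚ)}
    (hU : ∀ n, U n ≤ LamDeg n) {f : MvPowerSeries ℕ+ ℚ} (hf : f ∈ ⨆ n, U n) (n : ℕ) :
    f.homogeneousComponent n ∈ U n := by
  suffices ⨆ m, U m ≤ (U n).comap (homogeneousComponent n) from this hf
  refine iSup_le fun m f hf => Submodule.mem_comap.2 ?_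
  rw [homogeneousComponent_of_mem_LamDeg (hU m hf)]
  split_ifs with h
  · exact h ▸ hf
  · exact zero_mem _

theorem iSupIndep_LamDeg : iSupIndep LamDeg := by
  refine fun n => Submodule.disjoint_def.2 fun f hf hf' => ?_
  have hker : ⨆ m, ⨆ _ : m ≠ n, LamDeg m ≤ (homogeneousComponent n).ker :=
    iSup₂_le fun m hm g hg => by
      rw [LinearMap.mem_ker, homogeneousComponent_of_mem_LamDeg hg, if_neg hm]
  have hf0 := LinearMap.mem_ker.1 (hker hf')
  rwa [homogeneousComponent_of_mem_LamDeg hf, if_pos rfl] at hf0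

instance : SetLike.GradedMonoid LamDeg where
  one_mem := ⟨fun τ => map_one _, fun {d} hd => by
    classical
    rw [coeff_one, ite_ne_right_iff] at hd
    rw [hd.1, map_zero]⟩
  mul_mem _ _ _ _ hf hg := ⟨fun τ => by rw [map_mul, hf.1 τ, hg.1 τ], IsHomogeneous.mul hf.2 hg.2⟩

theorem LamDeg_le_Lam (n : ℕ) : LamDeg n ≤ Subalgebra.toSubmodule Lam := fun _ hf =>
  ⟨hf.1, n, fun _ hd => (not_imp_comm.1 (IsHomogeneous.coeff_eq_zero hf.2) hd).le⟩

theorem toSubmodule_Lam : Subalgebra.toSubmodule Lam = ⨆ n, LamDeg n := by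
  refine le_antisymm ?_ (iSup_le LamDeg_le_Lam)
  rintro f ⟨hf, N, hN⟩
  have hsum : f = ∑ n ∈ range (N + 1), f.homogeneousComponent n := by
    ext d
    simp only [map_sum, coeff_homogeneousComponent, sum_ite_eq, mem_range, Nat.lt_succ_iff]
    exact (ite_eq_left_iff.2 fun hd => (not_imp_comm.1 (hN d) hd).symm).symm
  rw [hsum]
  exact Submodule.sum_mem _ fun n _ =>
    Submodule.mem_iSup_of_mem n ⟨hf.homogeneousComponent n, isHomogeneous_homogeneousComponent f n⟩

end SymmetricFunctions

section PartitionProducts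

theorem map_part {n : ℕ} (p : n.Partition) :
    (univ.val.map fun i => (part p i : ℕ)) = p.parts :=
  Multiset.map_univ_coe p.parts

theorem sum_part {n : ℕ} (p : n.Partition) : ∑ i, (part p i : ℕ) = n :=
  (congrArg Multiset.sum (map_part p)).trans p.parts_sum

/-- A multiset of positive integers as a partition of its sum. -/
def partitionOfMultiset (m : Multiset ℕ+) : (m.map PNat.val).sum.Partition where
  parts := m.map PNat.val
  parts_pos h := by
    obtain ⟨k, -, rfl⟩ := Multiset.mem_map.1 h
    exact k.pos
  parts_sum := rfl

theorem partitionOfMultiset_injective : Function.Injective fun m : Multiset ℕ+ =>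
    (⟨_, partitionOfMultiset m⟩ : Σ n : ℕ, n.Partition) := fun _ _ h =>
  Multiset.map_injective PNat.coe_injective (congrArg (fun q => q.2.parts) h)

variable {A : Type*} [CommMonoid A]

/-- The product `Y_λ = Y_{λ₁} ⋯ Y_{λ_ℓ}` attached to a sequence `Y₁, Y₂, …` and a partition
`λ = (λ₁, …, λ_ℓ)`. -/
def partProd (Y : ℕ+ → A) {n : ℕ} (p : n.Partition) : A :=
  ∏ i, Y (part p i)

theorem partProd_partitionOfMultiset (Y : ℕ+ → A) (m : Multiset ℕ+) :
    partProd Y (partitionOfMultiset m) = (m.map Y).prod := by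
  have hm : univ.val.map (part (partitionOfMultiset m)) = m :=
    Multiset.map_injective PNat.coe_injective <| by
      rw [Multiset.map_map]
      exact map_part (partitionOfMultiset m)
  conv_rhs => rw [← hm, Multiset.map_map]
  rfl

theorem partProd_toMultiset (Y : ℕ+ → A) (s : ℕ+ →₀ ℕ) :
    partProd Y (partitionOfMultiset (Finsupp.toMultiset s)) = s.prod fun k n => Y k ^ n := by
  rw [partProd_partitionOfMultiset, Finsupp.toMultiset_map, Finsupp.prod_toMultiset,
    Finsupp.prod_mapDomain_index (fun _ => pow_zero _) fun _ => pow_add _]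

theorem toSubmodule_adjoin_range_eq_iSup_span_partProd {R A : Type*} [CommSemiring R]
    [CommSemiring A] [Algebra R A] (Y : ℕ+ → A) :
    Subalgebra.toSubmodule (Algebra.adjoin R (Set.range Y)) =
      ⨆ n : ℕ, Submodule.span R (Set.range (partProd Y : n.Partition → A)) := by
  refine le_antisymm ?_ (iSup_le fun n => Submodule.span_le.2 ?_)
  · rw [Algebra.adjoin_eq_span, Submodule.span_le]
    intro x hx
    obtain ⟨s, rfl⟩ := Submonoid.exists_finsupp_of_mem_closure_range Y x hx
    rw [← partProd_toMultiset]
    exact Submodule.mem_iSup_of_mem _ (Submodule.subset_span (Set.mem_range_self _))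
  · rintro _ ⟨p, rfl⟩
    exact Subalgebra.prod_mem _ fun i _ => Algebra.subset_adjoin (Set.mem_range_self _)

theorem algebraicIndependent_of_linearIndependent_partProd {R A : Type*} [CommRing R]
    [CommRing A] [Algebra R A] {Y : ℕ+ → A}
    (h : LinearIndependent R fun q : Σ n : ℕ, n.Partition => partProd Y q.2) :
    AlgebraicIndependent R Y := by
  let toPartition (s : ℕ+ →₀ ℕ) : Σ n : ℕ, n.Partition :=
    ⟨_, partitionOfMultiset (Finsupp.toMultiset s)⟩
  have toPartition_injective : Function.Injective toPartition :=
    partitionOfMultiset_injective.comp Multiset.toFinsupp.symm.injective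
  have aeval_comp_monomials :
      (MvPolynomial.aeval Y).toLinearMap ∘ MvPolynomial.basisMonomials ℕ+ R =
        (fun q => partProd Y q.2) ∘ toPartition := by
    ext s
    simp only [Function.comp_apply, MvPolynomial.coe_basisMonomials, AlgHom.toLinearMap_apply,
      MvPolynomial.aeval_monomial, map_one, one_mul]
    exact (partProd_toMultiset Y s).symm
  refine LinearMap.injective_of_linearIndependent (f := (MvPolynomial.aeval Y).toLinearMap)
    (MvPolynomial.basisMonomials ℕ+ R).span_eq ?_
  rw [aeval_comp_monomials]
  exact h.comp _ toPartition_injective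

end PartitionProducts

section LinearIndependence

theorem linearIndependent_sigma_of_iSupIndep {R M ι : Type*} {κ : ι → Type*} [Ring R]
    [AddCommGroup M] [Module R M] {p : ι → Submodule R M} (hp : iSupIndep p)
    {v : ∀ i, κ i → M} (hv : ∀ i, LinearIndependent R (v i)) (hmem : ∀ i j, v i j ∈ p i) :
    LinearIndependent R fun ij : Σ i, κ i => v ij.1 ij.2 := by
  have hspan (i) : Submodule.span R (Set.range (v i)) ≤ p i :=
    Submodule.span_le.2 (Set.range_subset_iff.2 (hmem i))
  refine linearIndependent_iUnion_finite hv fun i t _ hi => (hp i).mono (hspan i) ?_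
  exact iSup₂_le fun j hj => le_iSup₂_of_le j (ne_of_mem_of_not_mem hj hi) (hspan j)

theorem linearIndependent_of_triangular {R M ι α : Type*} [Ring R] [NoZeroDivisors R]
    [AddCommGroup M] [Module R M] [LinearOrder α] (v : ι → M) (φ : ι → M →ₗ[R] R) (rank : ι → α)
    (hdiag : ∀ i, φ i (v i) ≠ 0) (htri : ∀ i j, φ i (v j) ≠ 0 → j = i ∨ rank i < rank j) :
    LinearIndependent R v := by
  rw [linearIndependent_iff]
  intro l hl
  by_contra hne
  obtain ⟨i, hi, hmax⟩ := l.support.exists_max_image rank (Finsupp.support_nonempty_iff.2 hne)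
  have h := congrArg (φ i) hl
  rw [Finsupp.linearCombination_apply, Finsupp.sum, map_sum, sum_eq_single_of_mem i hi, map_smul,
    map_zero] at h
  · exact mul_ne_zero (Finsupp.mem_support_iff.1 hi) (hdiag i) h
  · intro j hj hji
    rw [map_smul]
    by_contra hc
    exact ((htri i j (right_ne_zero_of_smul hc)).resolve_left hji).not_ge (hmax j hj)

end LinearIndependence

section PowerSum

variable {σ R : Type*}

instance tendstoCofinite_single (k : ℕ+) :
    TendstoCofinite fun i : σ => Finsupp.single i (k : ℕ) :=
  Filter.tendstoCofinite_of_injective (Finsupp.single_left_injective k.ne_zero)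

/-- The power sum symmetric function `p_k = ∑ i, x_i ^ k`. -/
def powerSum [Semiring R] (k : ℕ+) : MvPowerSeries σ R :=
  countSeries fun i => Finsupp.single i (k : ℕ)

theorem prod_powerSum [CommSemiring R] {V : Type*} [Fintype V] (w : V → ℕ+) :
    ∏ v, (powerSum (w v) : MvPowerSeries σ R) = countSeries (weightedContent w) :=
  prod_countSeries fun v i => Finsupp.single i (w v : ℕ)

theorem powerSum_mem_LamDeg (k : ℕ+) : powerSum k ∈ LamDeg k :=
  countSeries_mem_LamDeg (fun τ => τ) (fun _ _ => Finsupp.mapDomain_single.symm)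
    fun _ => Finsupp.degree_single _ _

theorem partProd_mem_LamDeg {Y : ℕ+ → MvPowerSeries ℕ+ ℚ} (hY : ∀ k : ℕ+, Y k ∈ LamDeg k) {n : ℕ}
    (p : n.Partition) : partProd Y p ∈ LamDeg n := by
  have h := SetLike.prod_mem_graded (F := univ) (A := LamDeg) _ _ (fun i _ => hY (part p i))
  rwa [sum_part] at h

theorem span_partProd_le_LamDeg {Y : ℕ+ → MvPowerSeries ℕ+ ℚ} (hY : ∀ k : ℕ+, Y k ∈ LamDeg k)
    (n : ℕ) : Submodule.span ℚ (Set.range (partProd Y : n.Partition → _)) ≤ LamDeg n :=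
  Submodule.span_le.2 (Set.range_subset_iff.2 (partProd_mem_LamDeg hY))

theorem partProd_powerSum {n : ℕ} (p : n.Partition) :
    (partProd powerSum p : MvPowerSeries ℕ+ ℚ) = countSeries (weightedContent (part p)) :=
  prod_powerSum (part p)

/-- An exponent vector whose nonzero entries are the parts of `p`, namely the weighted content of a
colouring of the parts by distinct colours. -/
def partitionExponent {n : ℕ} (p : n.Partition) : ℕ+ →₀ ℕ :=
  weightedContent (part p) fun i => Nat.succPNat (Fintype.equivFin _ i)

theorem exponents_partitionExponent {n : ℕ} (p : n.Partition) :
    exponents (partitionExponent p) = p.parts := by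
  refine (exponents_weightedContent _ fun i j h => ?_).trans (map_part p)
  exact (Fintype.equivFin _).injective (Fin.ext (Nat.succPNat_injective h))

theorem coeff_partitionExponent_partProd_powerSum_self {n : ℕ} (p : n.Partition) :
    coeff (partitionExponent p) (partProd powerSum p : MvPowerSeries ℕ+ ℚ) ≠ 0 := by
  rw [partProd_powerSum]
  exact coeff_countSeries_ne_zero _ _

theorem exponents_eq_or_card_lt_of_coeff_partProd_powerSum_ne_zero {n : ℕ} {p : n.Partition}
    {d : ℕ+ →₀ ℕ} (h : coeff d (partProd powerSum p : MvPowerSeries ℕ+ ℚ) ≠ 0) :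
    exponents d = p.parts ∨ (exponents d).card < p.parts.card := by
  rw [partProd_powerSum] at h
  obtain ⟨κ, rfl⟩ := exists_eq_of_coeff_countSeries_ne_zero h
  have hcard : p.parts.card = Fintype.card p.parts.ToType := (Multiset.card_coe _).symm
  rw [card_exponents, support_weightedContent, hcard]
  refine card_image_le.eq_or_lt.imp_left fun hκ => ?_
  have hκ' : Function.Injective κ := Set.injOn_univ.1 (by simpa using card_image_iff.1 hκ)
  exact (exponents_weightedContent _ hκ').trans (map_part p)

theorem linearIndependent_partProd_powerSum (n : ℕ) :
    LinearIndependent ℚ (partProd powerSum : n.Partition → MvPowerSeries ℕ+ ℚ) := by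
  refine linearIndependent_of_triangular _ (fun p => coeff (partitionExponent p))
    (fun p => p.parts.card) coeff_partitionExponent_partProd_powerSum_self fun p q h => ?_
  have h' := exponents_eq_or_card_lt_of_coeff_partProd_powerSum_ne_zero h
  rw [exponents_partitionExponent] at h'
  exact h'.imp_left fun hpq => Nat.Partition.ext hpq.symm

/-- The coefficients of a homogeneous symmetric function at one monomial for each partition. -/
def partitionCoeff (n : ℕ) : LamDeg n →ₗ[ℚ] n.Partition → ℚ :=
  LinearMap.pi fun p => coeff (partitionExponent p) ∘ₗ (LamDeg n).subtype

theorem partitionCoeff_injective (n : ℕ) : Function.Injective (partitionCoeff n) := by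
  refine (injective_iff_map_eq_zero _).2 ?_
  rintro ⟨f, hf⟩ h
  refine Subtype.ext (MvPowerSeries.ext fun d => ?_)
  by_cases hd : d.degree = n
  · have exponents_pos {k : ℕ} (hk : k ∈ exponents d) : 0 < k := by
      obtain ⟨i, hi, rfl⟩ := Multiset.mem_map.1 hk
      exact Nat.pos_of_ne_zero (Finsupp.mem_support_iff.1 hi)
    let p : n.Partition := ⟨exponents d, exponents_pos, hd⟩
    have hdp : exponents d = exponents (partitionExponent p) := (exponents_partitionExponent p).symm
    exact (hf.1.coeff_eq_of_exponents_eq hdp).trans (congrFun h p)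
  · exact IsHomogeneous.coeff_eq_zero hf.2 hd

instance (n : ℕ) : Module.Finite ℚ (LamDeg n) :=
  Module.Finite.of_injective _ (partitionCoeff_injective n)

theorem finrank_LamDeg_le (n : ℕ) : Module.finrank ℚ (LamDeg n) ≤ Fintype.card n.Partition := by
  simpa using LinearMap.finrank_le_finrank_of_injective (partitionCoeff_injective n)

theorem span_partProd_powerSum (n : ℕ) :
    Submodule.span ℚ (Set.range (partProd powerSum : n.Partition → _)) = LamDeg n :=
  Submodule.eq_of_le_of_finrank_le (span_partProd_le_LamDeg powerSum_mem_LamDeg n) <| by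
    rw [finrank_span_eq_card (linearIndependent_partProd_powerSum n)]
    exact finrank_LamDeg_le n

theorem finrank_LamDeg (n : ℕ) : Module.finrank ℚ (LamDeg n) = Fintype.card n.Partition := by
  rw [← span_partProd_powerSum, finrank_span_eq_card (linearIndependent_partProd_powerSum n)]

theorem adjoin_powerSum : Algebra.adjoin ℚ (Set.range powerSum) = Lam := by
  refine Subalgebra.toSubmodule_injective ?_
  rw [toSubmodule_adjoin_range_eq_iSup_span_partProd, toSubmodule_Lam]
  exact iSup_congr span_partProd_powerSum

end PowerSum

section Generators

variable {Y : ℕ+ → MvPowerSeries ℕ+ ℚ} (hY : ∀ k : ℕ+, Y k ∈ LamDeg k)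
  (hgen : Algebra.adjoin ℚ (Set.range Y) = Lam)
include hY hgen

theorem span_partProd_of_adjoin_eq_Lam (n : ℕ) :
    Submodule.span ℚ (Set.range (partProd Y : n.Partition → _)) = LamDeg n := by
  refine le_antisymm (span_partProd_le_LamDeg hY n) fun f hf => ?_
  have hmem : f ∈ ⨆ n : ℕ, Submodule.span ℚ (Set.range (partProd Y : n.Partition → _)) := by
    rw [← toSubmodule_adjoin_range_eq_iSup_span_partProd, hgen]
    exact LamDeg_le_Lam n hf
  have := homogeneousComponent_mem_of_mem_iSup (span_partProd_le_LamDeg hY) hmem n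
  rwa [homogeneousComponent_of_mem_LamDeg hf, if_pos rfl] at this

theorem linearIndependent_partProd_of_adjoin_eq_Lam (n : ℕ) :
    LinearIndependent ℚ (partProd Y : n.Partition → MvPowerSeries ℕ+ ℚ) := by
  rw [linearIndependent_iff_card_eq_finrank_span, Set.finrank,
    span_partProd_of_adjoin_eq_Lam hY hgen, finrank_LamDeg]

theorem exists_basis_LamDeg_of_adjoin_eq_Lam (n : ℕ) :
    ∃ b : Module.Basis n.Partition ℚ (LamDeg n),
      ∀ p, (b p : MvPowerSeries ℕ+ ℚ) = partProd Y p := by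
  let b := Module.Basis.span (linearIndependent_partProd_of_adjoin_eq_Lam hY hgen n)
  refine ⟨b.map (LinearEquiv.ofEq _ _ (span_partProd_of_adjoin_eq_Lam hY hgen n)), fun p => ?_⟩
  simp [b, Module.Basis.span_apply]

theorem algebraicIndependent_of_adjoin_eq_Lam : AlgebraicIndependent ℚ Y :=
  algebraicIndependent_of_linearIndependent_partProd <|
    linearIndependent_sigma_of_iSupIndep iSupIndep_LamDeg
      (linearIndependent_partProd_of_adjoin_eq_Lam hY hgen) fun _ => partProd_mem_LamDeg hY

end Generators

section WeightedCsf

variable {σ R V : Type*} [Fintype V]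

instance tendstoCofinite_weightedContent_coloring (G : SimpleGraph V) (w : V → ℕ+) :
    TendstoCofinite fun κ : G.Coloring σ => weightedContent w κ :=
  have : TendstoCofinite fun (κ : G.Coloring σ) v => κ v :=
    Filter.tendstoCofinite_of_injective DFunLike.coe_injective
  TendstoCofinite.comp (fun (κ : G.Coloring σ) v => κ v) (weightedContent w)

/-- The chromatic symmetric function `∑ κ, ∏ v, x_{κ v} ^ (w v)` of a graph whose vertices carry
positive weights. Unlike `csf`, it satisfies a deletion–contraction recurrence, because a contracted
vertex can remember the number of vertices that it replaces. -/
def weightedCsf [Semiring R] (G : SimpleGraph V) (w : V → ℕ+) : MvPowerSeries σ R :=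
  countSeries fun κ : G.Coloring σ => weightedContent w κ

theorem csf_eq_weightedCsf (G : SimpleGraph V) : csf G = weightedCsf G 1 := rfl

theorem weightedCsf_mem_LamDeg (G : SimpleGraph V) (w : V → ℕ+) :
    weightedCsf G w ∈ LamDeg (∑ v, (w v : ℕ)) :=
  countSeries_mem_LamDeg G.recolorOfEquiv (fun τ κ => (mapDomain_weightedContent τ w κ).symm)
    fun κ => degree_weightedContent w κ

theorem csf_mem_LamDeg (G : SimpleGraph V) : csf G ∈ LamDeg (Fintype.card V) := by
  simpa [csf_eq_weightedCsf] using weightedCsf_mem_LamDeg G 1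

theorem weightedCsf_bot [CommSemiring R] (w : V → ℕ+) :
    (weightedCsf ⊥ w : MvPowerSeries σ R) = ∏ v, powerSum (w v) := by
  rw [prod_powerSum]
  let e : (⊥ : SimpleGraph V).Coloring σ ≃ (V → σ) :=
    { toFun := fun κ => κ
      invFun := fun f => .mk f False.elim
      left_inv := fun _ => rfl
      right_inv := fun _ => rfl }
  exact countSeries_congr e fun _ => rfl

/-- A colouring of a disjoint union amounts to a colouring of every component. -/
def coloringDisjointUnionEquiv {ι : Type*} {W : ι → Type*} (G : ∀ i, SimpleGraph (W i)) :
    (disjointUnion G).Coloring σ ≃ ∀ i, (G i).Coloring σ where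
  toFun κ i := .mk (fun a => κ ⟨i, a⟩) fun {a b} h =>
    κ.valid ((disjointUnion_adj G _ _).2 ⟨i, a, b, h, rfl, rfl⟩)
  invFun κ := .mk (fun x => κ x.1 x.2) fun {x y} h => by
    obtain ⟨i, a, b, hab, rfl, rfl⟩ := (disjointUnion_adj G x y).1 h
    exact (κ i).valid hab
  left_inv _ := rfl
  right_inv _ := rfl

theorem csf_disjointUnion {ι : Type*} [Fintype ι] {W : ι → Type*} [∀ i, Fintype (W i)]
    (G : ∀ i, SimpleGraph (W i)) : csf (disjointUnion G) = ∏ i, csf (G i) := by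
  simp only [csf_eq_weightedCsf, weightedCsf]
  rw [prod_countSeries]
  refine countSeries_congr (coloringDisjointUnionEquiv G) fun κ => ?_
  exact (Fintype.sum_sigma fun x => Finsupp.single (κ x) 1).symm

theorem csf_partitionGraph {V : ℕ+ → Type*} [∀ k, Fintype (V k)] (G : ∀ k, SimpleGraph (V k))
    {n : ℕ} (p : n.Partition) : csf (partitionGraph G p) = partProd (fun k => csf (G k)) p :=
  csf_disjointUnion fun i => G (part p i)

end WeightedCsf

section DeletionContraction

theorem connected_map_of_surjective {V W : Type*} {G : SimpleGraph V} (hG : G.Connected)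
    {f : V → W} (hf : Function.Surjective f) : (G.map f).Connected := by
  have reachable_of_adj (x y : V) (h : G.Adj x y) : (G.map f).Reachable (f x) (f y) := by
    by_cases hne : f x = f y
    · rw [hne]
    · exact (SimpleGraph.map_adj_apply' h hne).reachable
  have reachable (x y : V) : (G.map f).Reachable (f x) (f y) := by
    simp only [SimpleGraph.reachable_iff_reflTransGen] at reachable_of_adj ⊢
    exact ((G.reachable_iff_reflTransGen x y).1 (hG.preconnected x y)).lift' f reachable_of_adj
  have := hG.nonempty.map f
  exact ⟨hf.forall₂.2 fun x y => reachable x y⟩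

variable {V : Type*} [DecidableEq V] {u v : V}

/-- The identification of `v` with another vertex `u`, as a map that deletes `v`. The contraction of
an edge `uv` of `G` is the graph `G.map (mergeVertex huv)`. -/
def mergeVertex (huv : u ≠ v) (x : V) : {x // x ≠ v} :=
  if hx : x = v then ⟨u, huv⟩ else ⟨x, hx⟩

theorem mergeVertex_self (huv : u ≠ v) : mergeVertex huv v = ⟨u, huv⟩ := dif_pos rfl

theorem mergeVertex_coe (huv : u ≠ v) (x : {x // x ≠ v}) : mergeVertex huv x = x := dif_neg x.2

theorem mergeVertex_eq_iff (huv : u ≠ v) {x y : V} :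
    mergeVertex huv x = mergeVertex huv y ↔ x = y ∨ s(x, y) = s(u, v) := by
  grind [mergeVertex]

theorem apply_mergeVertex {α : Type*} {f : V → α} (huv : u ≠ v) (hf : f u = f v) (x : V) :
    f (mergeVertex huv x) = f x := by
  grind [mergeVertex]

theorem connected_map_mergeVertex {G : SimpleGraph V} (hG : G.Connected) (huv : u ≠ v) :
    (G.map (mergeVertex huv)).Connected :=
  connected_map_of_surjective hG fun x => ⟨x, mergeVertex_coe huv x⟩

/-- The weights on the contraction of `uv`: the merged vertex `u` has the weight of `u` and `v`
together. -/
def mergeWeight (w : V → ℕ+) (u v : V) (x : {x // x ≠ v}) : ℕ+ :=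
  if x = u then w x + w v else w x

theorem sum_mergeWeight [Fintype V] {M : Type*} [AddCommMonoid M] (w : V → ℕ+) (huv : u ≠ v)
    (g : {x // x ≠ v} → ℕ →+ M) :
    ∑ x, g x (mergeWeight w u v x) = ∑ x, g (mergeVertex huv x) (w x) := by
  have split_weight (x : {x // x ≠ v}) : g x (mergeWeight w u v x) =
      g x (w x) + if x = ⟨u, huv⟩ then g x (w v) else 0 := by
    simp only [mergeWeight, Subtype.ext_iff]
    split_ifs <;> simp
  rw [Fintype.sum_eq_add_sum_subtype_ne _ v, add_comm]
  simp only [split_weight, sum_add_distrib, sum_ite_eq', mem_univ, if_true, mergeVertex_self,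
    mergeVertex_coe]

variable {σ : Type*} {G : SimpleGraph V}

/-- The colourings of `G` are those of `G - uv` that separate `u` and `v`. -/
def deleteEdgeColoringEquiv (h : G.Adj u v) :
    {κ : (G.deleteEdges {s(u, v)}).Coloring σ // κ u ≠ κ v} ≃ G.Coloring σ where
  toFun κ := .mk κ.1 fun {a b} hab => by
    by_cases hs : s(a, b) = s(u, v)
    · obtain ⟨rfl, rfl⟩ | ⟨rfl, rfl⟩ := Sym2.eq_iff.1 hs
      exacts [κ.2, κ.2.symm]
    · exact κ.1.valid (SimpleGraph.deleteEdges_adj.2 ⟨hab, hs⟩)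
  invFun κ := ⟨.mk κ fun hab => κ.valid (SimpleGraph.deleteEdges_adj.1 hab).1, κ.valid h⟩
  left_inv _ := rfl
  right_inv _ := rfl

/-- The colourings of the contraction of `uv` are the colourings of `G - uv` that identify `u` and
`v`. -/
def contractionColoringEquiv (huv : u ≠ v) :
    {κ : (G.deleteEdges {s(u, v)}).Coloring σ // ¬κ u ≠ κ v} ≃
      (G.map (mergeVertex huv)).Coloring σ where
  toFun κ := .mk (fun x => κ.1 x) fun {x y} hxy => by
    obtain ⟨hne, a, b, hab, rfl, rfl⟩ := hxy
    simp only [apply_mergeVertex huv (not_not.1 κ.2)]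
    refine κ.1.valid (SimpleGraph.deleteEdges_adj.2 ⟨hab, fun hs => hne ?_⟩)
    exact (mergeVertex_eq_iff huv).2 (.inr hs)
  invFun κ := ⟨.mk (κ ∘ mergeVertex huv) fun {a b} hab => by
    obtain ⟨hab, hs⟩ := SimpleGraph.deleteEdges_adj.1 hab
    refine κ.valid (SimpleGraph.map_adj_apply' hab fun h => ?_)
    exact ((mergeVertex_eq_iff huv).1 h).elim hab.ne hs,
    not_not.2 (congrArg κ ((mergeVertex_eq_iff huv).2 (.inr rfl)))⟩
  left_inv κ := Subtype.ext (DFunLike.ext _ _ (apply_mergeVertex huv (not_not.1 κ.2)))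
  right_inv κ := DFunLike.ext _ _ fun x => congrArg κ (mergeVertex_coe huv x)

theorem weightedContent_mergeWeight [Fintype V] (w : V → ℕ+) (huv : u ≠ v)
    (κ : {x // x ≠ v} → σ) :
    weightedContent (mergeWeight w u v) κ = weightedContent w (κ ∘ mergeVertex huv) :=
  sum_mergeWeight w huv fun x => Finsupp.singleAddHom (κ x)

theorem weightedCsf_deleteEdges {R : Type*} [Semiring R] [Fintype V] (w : V → ℕ+)
    (h : G.Adj u v) :
    (weightedCsf (G.deleteEdges {s(u, v)}) w : MvPowerSeries σ R) =
      weightedCsf G w + weightedCsf (G.map (mergeVertex h.ne)) (mergeWeight w u v) := by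
  classical
  simp only [weightedCsf]
  rw [← countSeries_sumElim]
  symm
  refine countSeries_congr ((Equiv.sumCongr (deleteEdgeColoringEquiv h).symm
    (contractionColoringEquiv h.ne).symm).trans (Equiv.sumCompl _)) ?_
  rintro (κ | κ)
  · rfl
  · exact (weightedContent_mergeWeight w h.ne κ).symm

end DeletionContraction

section LeadingCoefficient

variable {σ R : Type*} [CommRing R]

theorem exists_weightedCsf_bot_sub_mem {V : Type*} [Fintype V] (w : V → ℕ+) (m : ℕ+)
    (hm : ∑ v, (w v : ℕ) = m) :
    ∃ c : ℕ, ((⊥ : SimpleGraph V).Connected → c ≠ 0) ∧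
      (weightedCsf ⊥ w : MvPowerSeries σ R) - ((-1) ^ (Fintype.card V + 1) * c : R) • powerSum m ∈
        Algebra.adjoin R (powerSum '' Set.Iio m) := by
  have : Nonempty V := by
    by_contra! h
    exact m.ne_zero (hm.symm.trans (Fintype.sum_empty _))
  rw [weightedCsf_bot]
  obtain hV | hV := subsingleton_or_nontrivial V
  · have := uniqueOfSubsingleton (Classical.arbitrary V)
    have hw : w default = m := PNat.coe_injective (by rw [← hm, Fintype.sum_unique])
    refine ⟨1, fun _ => one_ne_zero, ?_⟩
    simp [hw, zero_mem]
  · refine ⟨0, fun h => absurd h.preconnected SimpleGraph.not_preconnected_bot, ?_⟩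
    rw [Nat.cast_zero, mul_zero, zero_smul, sub_zero]
    refine Subalgebra.prod_mem _ fun v _ => Algebra.subset_adjoin ⟨w v, ?_, rfl⟩
    obtain ⟨v', hv'⟩ := exists_ne v
    have hlt : (w v : ℕ) < ∑ v, (w v : ℕ) :=
      single_lt_sum (f := fun v => (w v : ℕ)) hv' (mem_univ v) (mem_univ v') (w v').pos
        fun _ _ _ => Nat.zero_le _
    exact (PNat.coe_lt_coe _ _).1 (hlt.trans_eq hm)

theorem exists_weightedCsf_sub_mem {V : Type*} [Fintype V] (G : SimpleGraph V) (w : V → ℕ+)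
    (m : ℕ+) (hm : ∑ v, (w v : ℕ) = m) :
    ∃ c : ℕ, (G.Connected → c ≠ 0) ∧
      (weightedCsf G w : MvPowerSeries σ R) - ((-1) ^ (Fintype.card V + 1) * c : R) • powerSum m ∈
        Algebra.adjoin R (powerSum '' Set.Iio m) := by
  classical
  induction hn : Fintype.card V generalizing V with
  | zero =>
    have := Fintype.card_eq_zero_iff.1 hn
    exact absurd (hm.symm.trans (Fintype.sum_empty _)) m.ne_zero
  | succ n ih_card =>
  induction G using WellFoundedLT.induction with | _ G ih_lt =>
  obtain rfl | hG := eq_or_ne G ⊥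
  · exact hn ▸ exists_weightedCsf_bot_sub_mem w m hm
  obtain ⟨u, v, huv⟩ := SimpleGraph.ne_bot_iff_exists_adj.1 hG
  have delete_lt : G.deleteEdges {s(u, v)} < G := by
    refine (SimpleGraph.deleteEdges_le _).lt_of_ne fun h => ?_
    rw [← h, SimpleGraph.deleteEdges_adj] at huv
    exact huv.2 rfl
  have sum_weight : ∑ x, (mergeWeight w u v x : ℕ) = m :=
    (sum_mergeWeight w huv.ne fun _ => AddMonoidHom.id ℕ).trans hm
  obtain ⟨c₁, -, h₁⟩ := ih_lt _ delete_lt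
  obtain ⟨c₂, hc₂, h₂⟩ := ih_card (G.map (mergeVertex huv.ne)) _ sum_weight (by simp [hn])
  refine ⟨c₁ + c₂, fun h => ?_, ?_⟩
  · have := hc₂ (connected_map_mergeVertex h huv.ne)
    lia
  · convert sub_mem h₁ h₂ using 1
    rw [weightedCsf_deleteEdges w huv]
    push_cast
    module

theorem adjoin_range_eq_of_sub_smul_mem {K A ι : Type*} [Field K] [CommRing A] [Algebra K A]
    [LinearOrder ι] [WellFoundedLT ι] {X Y : ι → A} {c : ι → K} (hc : ∀ k, c k ≠ 0)
    (h : ∀ k, X k - c k • Y k ∈ Algebra.adjoin K (Y '' Set.Iio k)) :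
    Algebra.adjoin K (Set.range X) = Algebra.adjoin K (Set.range Y) := by
  refine le_antisymm (Algebra.adjoin_le ?_) (Algebra.adjoin_le ?_)
  · rintro _ ⟨k, rfl⟩
    rw [← sub_add_cancel (X k) (c k • Y k)]
    exact add_mem (Algebra.adjoin_mono (Set.image_subset_range _ _) (h k))
      (Subalgebra.smul_mem _ (Algebra.subset_adjoin (Set.mem_range_self k)) _)
  · rintro _ ⟨k, rfl⟩
    induction k using WellFoundedLT.induction with | _ k ih =>
    have hY : Y '' Set.Iio k ⊆ Algebra.adjoin K (Set.range X) := Set.image_subset_iff.2 ih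
    have hcY : c k • Y k ∈ Algebra.adjoin K (Set.range X) := by
      rw [← sub_sub_cancel (X k) (c k • Y k)]
      exact sub_mem (Algebra.subset_adjoin (Set.mem_range_self k)) (Algebra.adjoin_le hY (h k))
    rw [← inv_smul_smul₀ (hc k) (Y k)]
    exact Subalgebra.smul_mem _ hcY _

theorem adjoin_csf_eq_Lam {V : ℕ+ → Type*} [∀ k, Fintype (V k)] {G : ∀ k, SimpleGraph (V k)}
    (hG : ∀ k, (G k).Connected) (hcard : ∀ k : ℕ+, Fintype.card (V k) = k) :
    Algebra.adjoin ℚ (Set.range fun k => csf (G k)) = Lam := by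
  have sum_weight (k : ℕ+) : ∑ v : V k, ((1 : V k → ℕ+) v : ℕ) = k := by simp [hcard]
  choose c hc hmem using fun k => exists_weightedCsf_sub_mem (σ := ℕ+) (R := ℚ) (G k) 1 k
    (sum_weight k)
  rw [← adjoin_powerSum]
  refine adjoin_range_eq_of_sub_smul_mem (fun k => ?_) hmem
  exact mul_ne_zero (by simp) (Nat.cast_ne_zero.2 (hc k (hG k)))

end LeadingCoefficient

end ChromaticBases

end

open ChromaticBases in
theorem mainTheorem1_general {V : ℕ+ → Type*} [∀ k, Fintype (V k)] (G : ∀ k : ℕ+, SimpleGraph (V k))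
    (hG : ∀ k, (G k).Connected) (hcard : ∀ k : ℕ+, Fintype.card (V k) = (k : ℕ)) :
    (∀ n : ℕ, ∃ b : Module.Basis n.Partition ℚ (LamDeg n),
      ∀ p : n.Partition, (b p : MvPowerSeries ℕ+ ℚ) = csf (partitionGraph G p)) ∧
    Algebra.adjoin ℚ (Set.range fun k : ℕ+ => csf (G k)) = Lam ∧
    AlgebraicIndependent ℚ (fun k : ℕ+ => csf (G k)) := by
  have hdeg (k : ℕ+) : csf (G k) ∈ LamDeg k := hcard k ▸ csf_mem_LamDeg (G k)
  have hgen := adjoin_csf_eq_Lam hG hcard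
  simp only [csf_partitionGraph]
  exact ⟨exists_basis_LamDeg_of_adjoin_eq_Lam hdeg hgen, hgen,
    algebraicIndependent_of_adjoin_eq_Lam hdeg hgen⟩

theorem mainTheorem1 {V : ℕ+ → Type*} [∀ k, Fintype (V k)] (T : ∀ k : ℕ+, SimpleGraph (V k))
    (hT : ∀ k, (T k).IsTree) (hcard : ∀ k : ℕ+, Fintype.card (V k) = (k : ℕ)) :
    (∀ n : ℕ, ∃ b : Module.Basis n.Partition ℚ (ChromaticBases.LamDeg n),
      ∀ p : n.Partition, (b p : MvPowerSeries ℕ+ ℚ) =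
        ChromaticBases.csf (ChromaticBases.partitionGraph T p)) ∧
    Algebra.adjoin ℚ (Set.range fun k : ℕ+ => ChromaticBases.csf (T k)) = ChromaticBases.Lam ∧
    AlgebraicIndependent ℚ (fun k : ℕ+ => ChromaticBases.csf (T k)) :=
  mainTheorem1_general T (fun k => (hT k).1) hcard
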